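/- Let $n\ge 0$ and $d\ge 1$ be integers and let $a_0,\dots,a_{d-1}\in\mathbb R$ be such that $p(s)=s^d+a_{d-1}s^{d-1}+\dots+a_1s+a_0$ is Hurwitz, i.e. every complex root of $p$ has negative real part. For a real $n\times n$ matrix $E$ with no eigenvalue in $(-\infty,0]$ let $\log E$ be its principal logarithm, the unique real matrix $A$ with $\exp(A)=E$ all of whose complex eigenvalues satisfy $-\pi<\operatorname{Im}z<\pi$. Consider the differential equation $$\dot E=e_2E-a_{d-1}E\log E,\qquad \dot e_i=e_{i+1}-a_{d-i}\log E\ \ (2\le i\le d-1),\qquad \dot e_d=-a_0\log E,$$ whose state $x=(E,e_2,\dots,e_d)$ consists of a matrix $E\in GL(n,\mathbb R)$ with no eigenvalue in $(-\infty,0]$ and arbitrary $e_2,\dots,e_d\in\mathbb R^{n\times n}$ (for $d=1$ it is read as $\dot E=-a_0E\log E$). Then $x^*=(I_n,0_n,\dots,0_n)$ is an equilibrium, and it is locally exponentially stable: there are $\delta,m,\alpha>0$ such that for every $x_0$ with $\|x_0-x^*\|<\delta$ there is a solution $x:[0,\infty)\to(\mathbb R^{n\times n})^d$ with $x(0)=x_0$,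 and every solution with $x(0)=x_0$ on an interval $[0,T)$, $0<T<\infty$, satisfies $$\|x(t)-x^*\|\le m\,e^{-\alpha t}\,\|x_0-x^*\|\qquad(0\le t<T).$$ Here $\|(E,e_2,\dots,e_d)\|$ is the maximum of the operator norms (induced by the Euclidean norm) of the components. -/

import Mathlib

/- Matrices carry the operator norm induced by the Euclidean norm. -/
open scoped Matrix.Norms.L2Operator

/-- `x` is a solution of the autonomous equation `ẋ = f x` on the time set `I`, staying in the
region `D` on which the vector field `f` is defined. -/
def IsSolutionOn {V : Type*} [NormedAddCommGroup V] [NormedSpace ℝ V]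
    (f : V → V) (D : Set V) (I : Set ℝ) (x : ℝ → V) : Prop :=
  ∀ t ∈ I, x t ∈ D ∧ HasDerivWithinAt x (f (x t)) I t

/-- `p` is an equilibrium of the vector field `f` with domain `D`. -/
def IsEquilibrium {V : Type*} [NormedAddCommGroup V] [NormedSpace ℝ V]
    (f : V → V) (D : Set V) (p : V) : Prop :=
  p ∈ D ∧ f p = 0

/-- Local exponential stability of `p` for `ẋ = f x` on `D`: there are `δ, m, α > 0` such that from
every initial value `x₀` with `‖x₀ - p‖ < δ` a solution exists for all `t ≥ 0`, and every solution
starting at `x₀`, on whatever interval `[0, T)` it is defined, satisfies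
`‖x t - p‖ ≤ m * exp (-α t) * ‖x₀ - p‖` there. -/
def LocallyExponentiallyStable {V : Type*} [NormedAddCommGroup V] [NormedSpace ℝ V]
    (f : V → V) (D : Set V) (p : V) : Prop :=
  ∃ δ > (0 : ℝ), ∃ m > (0 : ℝ), ∃ α > (0 : ℝ), ∀ x₀ : V, ‖x₀ - p‖ < δ →
    (∃ x : ℝ → V, x 0 = x₀ ∧ IsSolutionOn f D (Set.Ici 0) x) ∧
    ∀ T > (0 : ℝ), ∀ x : ℝ → V, x 0 = x₀ → IsSolutionOn f D (Set.Ico 0 T) x →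
      ∀ t ∈ Set.Ico 0 T, ‖x t - p‖ ≤ m * Real.exp (-α * t) * ‖x₀ - p‖

/-- The real matrix `A` is a principal logarithm of `X`: `exp A = X`, and all complex eigenvalues of
`A` lie in the strip `-π < Im z < π`. -/
def IsPrincipalLog {n : ℕ} (X A : Matrix (Fin n) (Fin n) ℝ) : Prop :=
  NormedSpace.exp A = X ∧
    ∀ z ∈ spectrum ℂ (A.map (algebraMap ℝ ℂ)), -Real.pi < z.im ∧ z.im < Real.pi

/-- The real matrices without eigenvalues in `(-∞, 0]` (in particular they are invertible): those on
which the principal logarithm is defined. -/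
def principalLogDomain (n : ℕ) : Set (Matrix (Fin n) (Fin n) ℝ) :=
  {X | ∀ μ ∈ spectrum ℝ X, 0 < μ}

open Classical in
/-- The principal logarithm of `X`. It exists and is unique for `X ∈ principalLogDomain n`, and is
only used there. -/
noncomputable def principalLog {n : ℕ} (X : Matrix (Fin n) (Fin n) ℝ) :
    Matrix (Fin n) (Fin n) ℝ :=
  if h : ∃ A, IsPrincipalLog X A then h.choose else 0

/-- The monic polynomial `s ^ d + a_{d-1} s ^ (d-1) + ⋯ + a_0`. -/
noncomputable def monicPoly {d : ℕ} (a : Fin d → ℝ) : Polynomial ℝ :=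
  Polynomial.X ^ d + ∑ i : Fin d, Polynomial.C (a i) * Polynomial.X ^ (i : ℕ)

/-- A real polynomial is Hurwitz if all its complex roots have negative real part. -/
def IsHurwitz (p : Polynomial ℝ) : Prop :=
  ∀ z : ℂ, Polynomial.aeval z p = 0 → z.re < 0

/-- The state `(E, e_2, …, e_d)` is stored as `x 0 = E`, `x j = e_{j+1}` for `0 < j < d`. This is
`e_{j+2}`, with the convention `e_{d+1} = 0`. -/
def nextState {n d : ℕ} (x : Fin d → Matrix (Fin n) (Fin n) ℝ) (j : Fin d) :
    Matrix (Fin n) (Fin n) ℝ :=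
  if h : (j : ℕ) + 1 < d then x ⟨j + 1, h⟩ else 0

/-- The right-hand side of
`Ė = e_2 E - a_{d-1} E log E`, `ė_i = e_{i+1} - a_{d-i} log E` (`2 ≤ i < d`), `ė_d = - a_0 log E`.
The component `j` is that of `e_{j+1}`, and `a j.rev = a_{d-1-j}`. -/
noncomputable def errorField {n d : ℕ} [NeZero d] (a : Fin d → ℝ)
    (x : Fin d → Matrix (Fin n) (Fin n) ℝ) : Fin d → Matrix (Fin n) (Fin n) ℝ :=
  fun j =>
    if j = 0 then nextState x j * x 0 - a j.rev • (x 0 * principalLog (x 0))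
    else nextState x j - a j.rev • principalLog (x 0)

/-- The states `(E, e_2, …, e_d)` for which `log E` is defined; `e_2, …, e_d` are arbitrary. -/
def errorDomain (n d : ℕ) [NeZero d] : Set (Fin d → Matrix (Fin n) (Fin n) ℝ) :=
  {x | x 0 ∈ principalLogDomain n}

/-- The point `(I_n, 0_n, …, 0_n)`. -/
def errorEquilibrium (n d : ℕ) [NeZero d] : Fin d → Matrix (Fin n) (Fin n) ℝ :=
  fun j => if j = 0 then 1 else 0

/-!
The proof is Lyapunov's indirect method. Near the identity the principal logarithm is the local
inverse of `exp`, so it is strictly differentiable at `1` with derivative the identity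
(`hasStrictFDerivAt_principalLog_one`). Consequently the vector field is strictly differentiable at
the equilibrium, and its derivative is the matrix `companionMatrix a` acting on `d`-tuples of
matrices (`hasStrictFDerivAt_errorField`). The eigenvalues of that matrix are roots of the Hurwitz
polynomial, so the linearized flow decays exponentially.

*The logarithm.* The point is that the principal logarithm, which is only known to be some
logarithm with spectrum in the strip, agrees near `1` with the local inverse `B` of `exp`. A
logarithm `A` of the same matrix commutes with `B`, because conjugation by `1 + s A` fixes `exp B`
and `exp` is injective near `B` (`Matrix.commute_of_exp_eq_exp`). On a joint eigenvector the
eigenvalues of `A` and `B` differ by an element of `2πiℤ` whose imaginary part is smaller than `2π`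
in absolute value, hence `A - B` is nilpotent with exponential `1`, hence zero
(`IsPrincipalLog.eq_of_commute`).

*Linear decay.* The spectrum of `exp C` consists of exponentials of eigenvalues of `C`, so it lies
in the open unit disc when the eigenvalues of `C` have negative real part, and Gelfand's formula
makes the powers of `exp C` tend to zero; this gives `‖exp (t A)‖ ≤ M exp (-β t)`
(`exists_norm_exp_smul_le`).

*Nonlinear decay.* If `y' = A y + o(y)`, then differentiating `s ↦ exp ((t - s) A) (y s)` bounds
`y t` by the linear decay plus a small multiple of the asserted bound, as long as that bound holds
before `t`; so there is no first time at which it fails (`norm_lt_of_perturbed_linear`). Solutions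
exist for all times since truncating the vector field by the radial retraction onto a small ball
makes it bounded and Lipschitz, while the decay estimate keeps the solution in that ball.
-/

/-! ### Eigenvectors and the matrix exponential -/

theorem Matrix.mem_spectrum_iff_exists_mulVec {K ι : Type*} [Field K] [Fintype ι] [DecidableEq ι]
    {A : Matrix ι ι K} {z : K} : z ∈ spectrum K A ↔ ∃ v : ι → K, v ≠ 0 ∧ A.mulVec v = z • v := by
  rw [← Matrix.spectrum_toLin', ← Module.End.hasEigenvalue_iff_mem_spectrum]
  constructor
  · intro h
    obtain ⟨v, hv⟩ := h.exists_hasEigenvector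
    exact ⟨v, hv.2, by simpa using hv.apply_eq_smul⟩
  · rintro ⟨v, hv, h⟩
    exact Module.End.hasEigenvalue_of_hasEigenvector (x := v)
      ⟨Module.End.mem_eigenspace_iff.2 (by simpa using h), hv⟩

/-- An eigenvalue of `A` has an eigenvector that is also an eigenvector of a given `B` commuting
with `A`. -/
theorem Matrix.exists_common_eigenvector {ι : Type*} [Fintype ι] [DecidableEq ι]
    {A B : Matrix ι ι ℂ} (h : Commute A B) {z : ℂ} (hz : z ∈ spectrum ℂ A) :
    ∃ v : ι → ℂ, v ≠ 0 ∧ A.mulVec v = z • v ∧ ∃ w : ℂ, B.mulVec v = w • v := by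
  rw [← Matrix.spectrum_toLin', ← Module.End.hasEigenvalue_iff_mem_spectrum] at hz
  have hmap : ∀ v ∈ Module.End.eigenspace (Matrix.toLin' A) z,
      Matrix.toLin' B v ∈ Module.End.eigenspace (Matrix.toLin' A) z := by
    intro v hv
    rw [Module.End.mem_eigenspace_iff] at hv ⊢
    simp only [Matrix.toLin'_apply] at hv ⊢
    rw [Matrix.mulVec_mulVec, h.eq, ← Matrix.mulVec_mulVec, hv, Matrix.mulVec_smul]
  have : Nontrivial (Module.End.eigenspace (Matrix.toLin' A) z) :=
    (Submodule.nontrivial_iff_ne_bot).2 hz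
  obtain ⟨w, hw⟩ := Module.End.exists_eigenvalue ((Matrix.toLin' B).restrict hmap)
  obtain ⟨v, hv⟩ := hw.exists_hasEigenvector
  refine ⟨v, fun h0 => hv.2 (Subtype.ext h0), ?_, w, ?_⟩
  · simpa using Module.End.mem_eigenspace_iff.1 v.2
  · simpa using congrArg Subtype.val hv.apply_eq_smul

theorem Matrix.hasSum_exp_mulVec {n : ℕ} (A : Matrix (Fin n) (Fin n) ℂ) (v : Fin n → ℂ) :
    HasSum (fun k : ℕ => ((k.factorial : ℂ)⁻¹) • (A ^ k).mulVec v)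
      ((NormedSpace.exp A).mulVec v) := by
  have h := NormedSpace.exp_series_hasSum_exp' (𝕂 := ℂ) A
  have h2 := h.map (Matrix.mulVecBilin ℂ ℂ |>.flip v).toAddMonoidHom
    (LinearMap.continuous_of_finiteDimensional (Matrix.mulVecBilin ℂ ℂ |>.flip v))
  simpa [Function.comp_def, Matrix.smul_mulVec] using h2

theorem Matrix.pow_mulVec_eq_smul {n : ℕ} {A : Matrix (Fin n) (Fin n) ℂ} {v : Fin n → ℂ} {z : ℂ}
    (h : A.mulVec v = z • v) (k : ℕ) : (A ^ k).mulVec v = z ^ k • v := by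
  induction k with
  | zero => simp
  | succ k ih => rw [pow_succ, ← Matrix.mulVec_mulVec, h, Matrix.mulVec_smul, ih, smul_smul,
    pow_succ']

theorem Matrix.exp_mulVec_eq_smul {n : ℕ} {A : Matrix (Fin n) (Fin n) ℂ} {v : Fin n → ℂ} {z : ℂ}
    (h : A.mulVec v = z • v) : (NormedSpace.exp A).mulVec v = Complex.exp z • v := by
  refine (Matrix.hasSum_exp_mulVec A v).unique ?_
  simp_rw [Matrix.pow_mulVec_eq_smul h, smul_smul]
  have := NormedSpace.exp_series_hasSum_exp' (𝕂 := ℂ) z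
  rw [← Complex.exp_eq_exp_ℂ] at this
  simpa using this.smul_const v

theorem Matrix.exists_exp_eq_of_mem_spectrum_exp {n : ℕ} {A : Matrix (Fin n) (Fin n) ℂ} {μ : ℂ}
    (h : μ ∈ spectrum ℂ (NormedSpace.exp A)) : ∃ z ∈ spectrum ℂ A, Complex.exp z = μ := by
  obtain ⟨v, hv, h1, w, h2⟩ :=
    Matrix.exists_common_eigenvector ((Commute.refl A).exp_left) h
  refine ⟨w, Matrix.mem_spectrum_iff_exists_mulVec.2 ⟨v, hv, h2⟩, ?_⟩
  rw [Matrix.exp_mulVec_eq_smul h2] at h1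
  exact smul_left_injective ℂ hv h1

/-- The hypotheses make `N` nilpotent. If `N ≠ 0`, some `w` has `N w ≠ 0 = N² w`, and then
`w = exp N w = w + N w`. -/
theorem Matrix.eq_zero_of_exp_eq_one {n : ℕ} {N : Matrix (Fin n) (Fin n) ℂ}
    (hN : NormedSpace.exp N = 1) (hs : ∀ z ∈ spectrum ℂ N, z = 0) : N = 0 := by
  by_contra hne
  obtain ⟨v, hv⟩ : ∃ v, N.mulVec v ≠ 0 := by
    by_contra! h
    exact hne (Matrix.ext_of_mulVec_single fun i => by rw [h, Matrix.zero_mulVec])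
  have htop : Module.End.maxGenEigenspace (Matrix.toLin' N) 0 = ⊤ := by
    rw [eq_top_iff, ← Module.End.iSup_maxGenEigenspace_eq_top (Matrix.toLin' N)]
    refine iSup_le fun z => ?_
    by_cases hz : z = 0
    · rw [hz]
    · have : Module.End.maxGenEigenspace (Matrix.toLin' N) z = ⊥ := by
        by_contra hb
        refine hz (hs z ?_)
        rw [← Matrix.spectrum_toLin', ← Module.End.hasEigenvalue_iff_mem_spectrum]
        exact Module.End.HasUnifEigenvalue.lt zero_lt_one (k := ⊤) hb
      rw [this]; exact bot_le
  have hk : ∃ k : ℕ, (N ^ k).mulVec v = 0 := by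
    have : v ∈ Module.End.maxGenEigenspace (Matrix.toLin' N) 0 := htop ▸ Submodule.mem_top
    obtain ⟨k, hk⟩ := (Module.End.mem_maxGenEigenspace _ _ _).1 this
    refine ⟨k, ?_⟩
    simpa [← Matrix.toLin'_pow] using hk
  classical
  obtain ⟨k, hk0, hkmin⟩ : ∃ k : ℕ, (N ^ (k + 2)).mulVec v = 0 ∧ (N ^ (k + 1)).mulVec v ≠ 0 := by
    have h0 := Nat.find_spec hk
    have hmin := fun m => Nat.find_min hk (m := m)
    generalize Nat.find hk = m at h0 hmin
    match m with
    | 0 => exact absurd (by simp_all) hv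
    | 1 => exact absurd (by simpa using h0) hv
    | k + 2 => exact ⟨k, h0, hmin (k + 1) (by omega)⟩
  set w := (N ^ k).mulVec v with hw
  have hpow : ∀ j, (N ^ j).mulVec w = (N ^ (k + j)).mulVec v := fun j => by
    rw [hw, Matrix.mulVec_mulVec, ← pow_add, add_comm]
  have hsum := Matrix.hasSum_exp_mulVec N w
  have h2 : HasSum (fun j : ℕ => ((j.factorial : ℂ)⁻¹) • (N ^ j).mulVec w)
      (∑ j ∈ Finset.range 2, ((j.factorial : ℂ)⁻¹) • (N ^ j).mulVec w) := by
    refine hasSum_sum_of_ne_finset_zero fun j hj => ?_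
    obtain ⟨i, rfl⟩ : ∃ i, j = 2 + i := ⟨j - 2, by simp at hj; omega⟩
    rw [hpow, show k + (2 + i) = i + (k + 2) by ring, pow_add, ← Matrix.mulVec_mulVec, hk0]
    simp
  have := hsum.unique h2
  rw [hN] at this
  simp [Finset.sum_range_succ] at this
  exact hkmin (by rw [← hpow 1]; simpa using this)

/-! ### The principal logarithm near the identity -/

section

open Filter Topology

/-- If `exp` has a left inverse near `B` and `exp A = exp B`, then `A` commutes with `B`:
conjugating `B` by `1 + s A` with `s` small moves it only slightly and does not change its
exponential. -/
theorem Matrix.commute_of_exp_eq_exp {n : ℕ} {A B : Matrix (Fin n) (Fin n) ℝ}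
    {g : Matrix (Fin n) (Fin n) ℝ → Matrix (Fin n) (Fin n) ℝ}
    (hg : ∀ᶠ Y in 𝓝 B, g (NormedSpace.exp Y) = Y) (h : NormedSpace.exp A = NormedSpace.exp B) :
    Commute A B := by
  have hcont : ContinuousAt (fun s : ℝ => (1 + s • A) * B * Ring.inverse (1 + s • A)) 0 := by
    have h1 : ContinuousAt (fun s : ℝ => 1 + s • A) 0 := by fun_prop
    have h2 : ContinuousAt (Ring.inverse : Matrix (Fin n) (Fin n) ℝ → _) (1 + (0 : ℝ) • A) := by
      simpa using NormedRing.inverse_continuousAt (1 : (Matrix (Fin n) (Fin n) ℝ)ˣ)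
    exact (h1.mul continuousAt_const).mul (ContinuousAt.comp (f := fun s : ℝ => 1 + s • A) h2 h1)
  have ht : Tendsto (fun s : ℝ => (1 + s • A) * B * Ring.inverse (1 + s • A)) (𝓝 0) (𝓝 B) := by
    simpa [ContinuousAt] using hcont
  have hunit : ∀ᶠ s : ℝ in 𝓝 0, IsUnit (1 + s • A) := by
    have h1 : Tendsto (fun s : ℝ => 1 + s • A) (𝓝 0) (𝓝 1) := by
      have : ContinuousAt (fun s : ℝ => 1 + s • A) 0 := by fun_prop
      simpa [ContinuousAt] using this
    exact h1.eventually (Units.isOpen.mem_nhds isUnit_one)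
  have hev : ∀ᶠ s : ℝ in 𝓝[≠] 0, IsUnit (1 + s • A) ∧
      g (NormedSpace.exp ((1 + s • A) * B * Ring.inverse (1 + s • A))) =
        (1 + s • A) * B * Ring.inverse (1 + s • A) :=
    ((hunit.and (ht.eventually hg)).filter_mono nhdsWithin_le_nhds)
  obtain ⟨s, ⟨hu, hgs⟩, hs⟩ := (hev.and self_mem_nhdsWithin).exists
  obtain ⟨u, hu⟩ := hu
  rw [← hu, Ring.inverse_unit, Matrix.exp_units_conj, ← h] at hgs
  have hc : (u : Matrix (Fin n) (Fin n) ℝ) * NormedSpace.exp A = NormedSpace.exp A * u := by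
    have : Commute A (NormedSpace.exp A) := (Commute.refl A).exp_right
    rw [hu, add_mul, mul_add, smul_mul_assoc, mul_smul_comm, this.eq, one_mul, mul_one]
  rw [hc, mul_assoc, Units.mul_inv, mul_one, h, hg.self_of_nhds] at hgs
  have h3 : (u : Matrix (Fin n) (Fin n) ℝ) * B = B * u := by
    rw [eq_comm, Units.mul_inv_eq_iff_eq_mul] at hgs
    exact hgs
  rw [hu, add_mul, mul_add, one_mul, mul_one, add_right_inj, smul_mul_assoc, mul_smul_comm] at h3
  exact smul_right_injective _ hs h3

theorem Matrix.exp_map_algebraMap {n : ℕ} (A : Matrix (Fin n) (Fin n) ℝ) :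
    NormedSpace.exp (A.map (algebraMap ℝ ℂ)) = (NormedSpace.exp A).map (algebraMap ℝ ℂ) := by
  let _ : NormedAlgebra ℚ (Matrix (Fin n) (Fin n) ℝ) := NormedAlgebra.restrictScalars ℚ ℝ _
  exact (NormedSpace.map_exp ((algebraMap ℝ ℂ).mapMatrix (m := Fin n))
    (continuous_id.matrix_map (continuous_algebraMap ℝ ℂ)) A).symm

/-- Two commuting principal logarithms coincide: `A - B` has exponential `1`, and its eigenvalues
are multiples of `2πi` with imaginary part in `(-2π, 2π)`. -/
theorem IsPrincipalLog.eq_of_commute {n : ℕ} {X A B : Matrix (Fin n) (Fin n) ℝ}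
    (hA : IsPrincipalLog X A) (hB : IsPrincipalLog X B) (hAB : Commute A B) : A = B := by
  have hc : Commute (A.map (algebraMap ℝ ℂ)) (B.map (algebraMap ℝ ℂ)) :=
    hAB.map ((algebraMap ℝ ℂ).mapMatrix (m := Fin n))
  have hsub : (A - B).map (algebraMap ℝ ℂ) = A.map (algebraMap ℝ ℂ) - B.map (algebraMap ℝ ℂ) :=
    map_sub ((algebraMap ℝ ℂ).mapMatrix (m := Fin n)) A B
  have hexp : NormedSpace.exp ((A - B).map (algebraMap ℝ ℂ)) = 1 := by
    have : NormedSpace.exp (A - B) = 1 := by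
      rw [sub_eq_add_neg, Matrix.exp_add_of_commute _ _ hAB.neg_right, hA.1, ← hB.1,
        ← Matrix.exp_add_of_commute _ _ (Commute.refl B).neg_right, add_neg_cancel,
        NormedSpace.exp_zero]
    rw [Matrix.exp_map_algebraMap, this, Matrix.map_one _ (map_zero _) (map_one _)]
  have hzero : (A - B).map (algebraMap ℝ ℂ) = 0 := by
    refine Matrix.eq_zero_of_exp_eq_one hexp fun z hz => ?_
    have hcomm : Commute ((A - B).map (algebraMap ℝ ℂ)) (A.map (algebraMap ℝ ℂ)) := by
      rw [hsub]; exact (Commute.refl _).sub_left hc.symm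
    obtain ⟨v, hv, h1, w, h2⟩ := Matrix.exists_common_eigenvector hcomm hz
    have h3 : (B.map (algebraMap ℝ ℂ)).mulVec v = (w - z) • v := by
      rw [sub_smul, ← h1, ← h2, hsub, Matrix.sub_mulVec, sub_sub_cancel]
    have hw := hA.2 w (Matrix.mem_spectrum_iff_exists_mulVec.2 ⟨v, hv, h2⟩)
    have hwz := hB.2 (w - z) (Matrix.mem_spectrum_iff_exists_mulVec.2 ⟨v, hv, h3⟩)
    have h4 := Matrix.exp_mulVec_eq_smul h1
    rw [hexp, Matrix.one_mulVec] at h4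
    have h5 : Complex.exp z = 1 := smul_left_injective ℂ hv (by simpa using h4.symm)
    obtain ⟨k, hk⟩ := Complex.exp_eq_one_iff.1 h5
    have him : z.im = k * (2 * Real.pi) := by simp [hk]
    rw [Complex.sub_im] at hwz
    have hk0 : k = 0 := by
      have h6 : (k : ℝ) * (2 * Real.pi) < 1 * (2 * Real.pi) := by rw [← him]; linarith
      have h7 : (-1 : ℝ) * (2 * Real.pi) < k * (2 * Real.pi) := by rw [← him]; linarith
      have h8 : (k : ℝ) < 1 := lt_of_mul_lt_mul_right h6 Real.two_pi_pos.le
      have h9 : (-1 : ℝ) < k := lt_of_mul_lt_mul_right h7 Real.two_pi_pos.le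
      have h8' : k < 1 := by exact_mod_cast h8
      have h9' : -1 < k := by exact_mod_cast h9
      omega
    rw [hk, hk0]; simp
  exact sub_eq_zero.1 (Matrix.map_injective (algebraMap ℝ ℂ).injective
    (hzero.trans (Matrix.map_zero _ (map_zero _)).symm))

theorem Matrix.eventually_spectrum_im_lt_pi (n : ℕ) :
    ∀ᶠ B in 𝓝 (0 : Matrix (Fin n) (Fin n) ℝ),
      ∀ z ∈ spectrum ℂ (B.map (algebraMap ℝ ℂ)), -Real.pi < z.im ∧ z.im < Real.pi := by
  have hcont : Continuous fun B : Matrix (Fin n) (Fin n) ℝ =>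
      ‖B.map (algebraMap ℝ ℂ)‖ * ‖(1 : Matrix (Fin n) (Fin n) ℂ)‖ :=
    (continuous_id.matrix_map (continuous_algebraMap ℝ ℂ)).norm.mul continuous_const
  have h0 : ‖(0 : Matrix (Fin n) (Fin n) ℝ).map (algebraMap ℝ ℂ)‖ *
      ‖(1 : Matrix (Fin n) (Fin n) ℂ)‖ < Real.pi := by
    rw [Matrix.map_zero _ (map_zero _), norm_zero, zero_mul]; exact Real.pi_pos
  filter_upwards [hcont.continuousAt.eventually_lt continuousAt_const h0] with B hB z hz
  have := (Complex.abs_im_le_norm z).trans_lt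
    ((spectrum.norm_le_norm_mul_of_mem hz).trans_lt hB)
  exact abs_lt.1 this

/-- Near `1` the principal logarithm is the local inverse of `exp` at `0`. -/
theorem hasStrictFDerivAt_principalLog_one (n : ℕ) :
    HasStrictFDerivAt (principalLog (n := n)) (ContinuousLinearMap.id ℝ _) 1 ∧
      principalLog (1 : Matrix (Fin n) (Fin n) ℝ) = 0 := by
  have hE : HasStrictFDerivAt (NormedSpace.exp : Matrix (Fin n) (Fin n) ℝ → _)
      ((ContinuousLinearEquiv.refl ℝ (Matrix (Fin n) (Fin n) ℝ) :) :
        Matrix (Fin n) (Fin n) ℝ →L[ℝ] Matrix (Fin n) (Fin n) ℝ) 0 :=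
    hasStrictFDerivAt_exp_zero
  have hexp0 : NormedSpace.exp (0 : Matrix (Fin n) (Fin n) ℝ) = 1 := NormedSpace.exp_zero
  set g := hE.localInverse with hg
  have hinv : ∀ᶠ X in 𝓝 (1 : Matrix (Fin n) (Fin n) ℝ), NormedSpace.exp (g X) = X := by
    rw [← hexp0]; exact hE.eventually_right_inverse
  have htend : Tendsto g (𝓝 1) (𝓝 0) := by
    rw [← hexp0]; exact hE.localInverse_tendsto
  have hev : principalLog =ᶠ[𝓝 1] g := by
    filter_upwards [hinv, htend.eventually hE.eventually_left_inverse.eventually_nhds,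
      htend.eventually (Matrix.eventually_spectrum_im_lt_pi n)] with X h1 h2 h3
    have hgX : IsPrincipalLog X (g X) := ⟨h1, h3⟩
    have hex : ∃ A, IsPrincipalLog X A := ⟨_, hgX⟩
    have hspec : IsPrincipalLog X (principalLog X) := by
      rw [principalLog, dif_pos hex]; exact hex.choose_spec
    exact hspec.eq_of_commute hgX (Matrix.commute_of_exp_eq_exp h2 (hspec.1.trans h1.symm))
  constructor
  · refine HasStrictFDerivAt.congr_of_eventuallyEq ?_ hev.symm
    rw [← hexp0]
    exact hE.to_localInverse
  · rw [hev.self_of_nhds, ← hexp0]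
    exact hE.localInverse_apply_image

end

/-! ### Exponential decay of linear flows -/

section

open Filter Topology

theorem tendsto_pow_zero_of_spectralRadius_lt_one {𝔸 : Type*} [NormedRing 𝔸] [NormedAlgebra ℂ 𝔸]
    [CompleteSpace 𝔸] {a : 𝔸} (ha : spectralRadius ℂ a < 1) :
    Tendsto (fun k : ℕ => a ^ k) atTop (𝓝 0) := by
  obtain ⟨r, har, hr1⟩ := ENNReal.lt_iff_exists_nnreal_btwn.1 ha
  have hr : (r : ℝ) < 1 := by exact_mod_cast hr1
  rw [tendsto_zero_iff_norm_tendsto_zero]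
  refine squeeze_zero' (Eventually.of_forall fun _ => norm_nonneg _) ?_
    (tendsto_pow_atTop_nhds_zero_of_lt_one r.2 hr)
  filter_upwards [
    (spectrum.pow_nnnorm_pow_one_div_tendsto_nhds_spectralRadius a).eventually_lt_const har,
    eventually_gt_atTop 0] with k hk hk0
  have hk' : (k : ℝ) ≠ 0 := by exact_mod_cast hk0.ne'
  have h1 := ENNReal.rpow_le_rpow hk.le (Nat.cast_nonneg (α := ℝ) k)
  rw [← ENNReal.rpow_mul, one_div, inv_mul_cancel₀ hk', ENNReal.rpow_one,
    ENNReal.rpow_natCast] at h1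
  exact_mod_cast h1

theorem Matrix.tendsto_exp_pow_zero {n : ℕ} [NeZero n] {C : Matrix (Fin n) (Fin n) ℂ}
    (hC : ∀ z ∈ spectrum ℂ C, z.re < 0) :
    Tendsto (fun k : ℕ => NormedSpace.exp C ^ k) atTop (𝓝 0) := by
  refine tendsto_pow_zero_of_spectralRadius_lt_one ?_
  refine spectrum.spectralRadius_lt_of_forall_lt (r := 1) _ fun μ hμ => ?_
  obtain ⟨z, hz, rfl⟩ := Matrix.exists_exp_eq_of_mem_spectrum_exp hμ
  rw [← NNReal.coe_lt_coe, coe_nnnorm, Complex.norm_exp]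
  simpa using hC z hz

/-- If the powers of `exp A` tend to zero, then `exp (t A)` decays exponentially: choose `k` with
`‖exp A ^ k‖ ≤ e⁻¹` and split `t` into a multiple of `k` and a remainder. -/
theorem exists_norm_exp_smul_le {𝔸 : Type*} [NormedRing 𝔸] [NormedAlgebra ℝ 𝔸] [CompleteSpace 𝔸]
    {A : 𝔸} (hA : Tendsto (fun k : ℕ => NormedSpace.exp A ^ k) atTop (𝓝 0)) :
    ∃ M ≥ (1 : ℝ), ∃ β > (0 : ℝ), ∀ t : ℝ, 0 ≤ t →
      ‖NormedSpace.exp (t • A)‖ ≤ M * Real.exp (-β * t) := by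
  let _ : NormedAlgebra ℚ 𝔸 := NormedAlgebra.restrictScalars ℚ ℝ 𝔸
  have hn := (tendsto_zero_iff_norm_tendsto_zero.1 hA).eventually_le_const
    (show (0 : ℝ) < Real.exp (-1) by positivity)
  obtain ⟨k, hk, hk0⟩ := (hn.and (eventually_gt_atTop 0)).exists
  have hkpos : (0 : ℝ) < k := by exact_mod_cast hk0
  obtain ⟨M₀, hM₀⟩ := isCompact_Icc.exists_bound_of_continuousOn (s := Set.Icc (0 : ℝ) k)
    (f := fun s : ℝ => NormedSpace.exp (s • A))
    (differentiable_exp_smul_const ℝ A).continuous.continuousOn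
  have hM₀' : 0 ≤ M₀ := (norm_nonneg _).trans (hM₀ 0 ⟨le_rfl, hkpos.le⟩)
  have hpow : ∀ (m : ℕ) (b : 𝔸), ‖(NormedSpace.exp A ^ k) ^ m * b‖ ≤ Real.exp (-1) ^ m * ‖b‖ := by
    intro m b
    induction m with
    | zero => simp
    | succ m ih =>
      rw [pow_succ', mul_assoc, pow_succ', mul_assoc]
      exact (norm_mul_le _ _).trans (mul_le_mul hk ih (norm_nonneg _) (Real.exp_pos _).le)
  refine ⟨max 1 (M₀ * Real.exp 1), le_max_left _ _, 1 / k, by positivity, fun t ht => ?_⟩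
  set m := ⌊t / k⌋₊ with hm
  have h1 : (m : ℝ) ≤ t / k := Nat.floor_le (by positivity)
  have h2 : t / k < m + 1 := Nat.lt_floor_add_one _
  have h1' : m * (k : ℝ) ≤ t := (le_div_iff₀ hkpos).1 h1
  have h2' : t < (m + 1) * (k : ℝ) := (div_lt_iff₀ hkpos).1 h2
  have hsplit : NormedSpace.exp (t • A) =
      (NormedSpace.exp A ^ k) ^ m * NormedSpace.exp ((t - m * k) • A) := by
    rw [← pow_mul, ← NormedSpace.exp_nsmul, ← NormedSpace.exp_add_of_commute]
    · congr 1
      rw [← Nat.cast_smul_eq_nsmul ℝ, ← add_smul]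
      congr 1; push_cast; ring
    · exact ((Commute.refl A).smul_right _).smul_left _
  rw [hsplit]
  refine (hpow m _).trans ?_
  calc Real.exp (-1) ^ m * ‖NormedSpace.exp ((t - m * k) • A)‖
      ≤ Real.exp (-1) ^ m * M₀ := by
        gcongr
        exact hM₀ _ ⟨by linarith, by linarith⟩
    _ = M₀ * Real.exp (-m) := by rw [← Real.exp_nat_mul, mul_neg_one, mul_comm]
    _ ≤ M₀ * Real.exp (1 + -(1 / k) * t) := by
        gcongr
        have : -(1 / (k : ℝ)) * t = -(t / k) := by ring
        linarith
    _ = (M₀ * Real.exp 1) * Real.exp (-(1 / k) * t) := by rw [Real.exp_add]; ring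
    _ ≤ _ := by gcongr; exact le_max_right _ _

end

/-! ### Global solutions of bounded Lipschitz equations -/

section

open Set Filter Topology Metric

variable {V : Type*} [NormedAddCommGroup V] [NormedSpace ℝ V]


/-- The radial retraction of a normed space onto the closed ball of radius `r` about `0`. -/
noncomputable def radialRetraction (r : ℝ) (x : V) : V := (r / max r ‖x‖) • x

theorem radialRetraction_of_norm_le {r : ℝ} (hr : 0 < r) {x : V} (hx : ‖x‖ ≤ r) :
    radialRetraction r x = x := by
  rw [radialRetraction, max_eq_left hx, div_self hr.ne', one_smul]

theorem norm_radialRetraction_le {r : ℝ} (hr : 0 < r) (x : V) : ‖radialRetraction r x‖ ≤ r := by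
  have hm : 0 < max r ‖x‖ := lt_max_of_lt_left hr
  rw [radialRetraction, norm_smul, Real.norm_of_nonneg (by positivity), div_mul_eq_mul_div,
    div_le_iff₀ hm]
  exact mul_le_mul_of_nonneg_left (le_max_right _ _) hr.le

theorem lipschitzWith_radialRetraction {r : ℝ} (hr : 0 < r) :
    LipschitzWith 2 (radialRetraction r : V → V) := by
  refine LipschitzWith.of_dist_le_mul fun x y => ?_
  rw [dist_eq_norm, dist_eq_norm]
  have hx : 0 < max r ‖x‖ := lt_max_of_lt_left hr
  have hy : 0 < max r ‖y‖ := lt_max_of_lt_left hr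
  have hxr : r / max r ‖x‖ ≤ 1 := (div_le_one hx).2 (le_max_left _ _)
  have hyr : ‖y‖ / max r ‖y‖ ≤ 1 := (div_le_one hy).2 (le_max_right _ _)
  have hd : |max r ‖y‖ - max r ‖x‖| ≤ ‖x - y‖ := by
    rw [abs_sub_comm]
    refine (abs_max_sub_max_le_max r ‖x‖ r ‖y‖).trans ?_
    simpa using abs_norm_sub_norm_le x y
  have e : radialRetraction r x - radialRetraction r y =
      (r / max r ‖x‖) • (x - y) + (r / max r ‖x‖ - r / max r ‖y‖) • y := by
    simp only [radialRetraction, smul_sub, sub_smul]; abel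
  have e2 : |r / max r ‖x‖ - r / max r ‖y‖| * ‖y‖ =
      (r / max r ‖x‖) * (‖y‖ / max r ‖y‖) * |max r ‖y‖ - max r ‖x‖| := by
    rw [div_sub_div _ _ hx.ne' hy.ne', abs_div, abs_of_pos (mul_pos hx hy),
      show r * max r ‖y‖ - max r ‖x‖ * r = r * (max r ‖y‖ - max r ‖x‖) by ring, abs_mul,
      abs_of_pos hr]
    field_simp
  rw [e]
  refine (norm_add_le _ _).trans ?_
  rw [norm_smul, norm_smul, Real.norm_eq_abs, Real.norm_eq_abs, e2, abs_of_pos (by positivity)]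
  have h1 : r / max r ‖x‖ * ‖x - y‖ ≤ 1 * ‖x - y‖ := by gcongr
  have h2 : (r / max r ‖x‖) * (‖y‖ / max r ‖y‖) * |max r ‖y‖ - max r ‖x‖| ≤ 1 * 1 * ‖x - y‖ := by
    gcongr
  push_cast
  linarith

/-- A bounded, globally Lipschitz vector field has a forward global solution through every point. -/
theorem exists_forward_solution_of_lipschitzWith [CompleteSpace V] {F : V → V} {K L : NNReal}
    (hK : LipschitzWith K F) (hL : ∀ x, ‖F x‖ ≤ L) (x₀ : V) :
    ∃ x : ℝ → V, x 0 = x₀ ∧ ∀ t ∈ Ici (0 : ℝ), HasDerivWithinAt x (F (x t)) (Ici 0) t := by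
  have hex : ∀ N : ℕ, ∃ x : ℝ → V, x 0 = x₀ ∧
      ∀ t ∈ Icc (0 : ℝ) N, HasDerivWithinAt x (F (x t)) (Icc (0 : ℝ) N) t := by
    intro N
    -- on a ball of radius `L N` a field bounded by `L` has solutions up to time `N`
    have hpl : IsPicardLindelof (fun _ : ℝ => F) (⟨0, by simp⟩ : Icc (0 : ℝ) N) x₀
        (L * N) 0 L K :=
      { lipschitzOnWith := fun _ _ => hK.lipschitzOnWith
        continuousOn := fun _ _ => continuousOn_const
        norm_le := fun _ _ x _ => hL x
        mul_max_le := by simp }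
    exact hpl.exists_eq_forall_mem_Icc_hasDerivWithinAt₀
  choose y hy0 hy using hex
  have hright : ∀ N : ℕ, ∀ t ∈ Ico (0 : ℝ) N, HasDerivWithinAt (y N) (F (y N t)) (Ici t) t := by
    intro N t ht
    refine ((hy N t ⟨ht.1, ht.2.le⟩).mono_of_mem_nhdsWithin ?_)
    exact mem_of_superset (Icc_mem_nhdsGE ht.2) (Icc_subset_Icc_left ht.1)
  -- the solutions on `[0, N]` are restrictions of each other, and are glued to one on `[0, ∞)`
  have huniq : ∀ M N : ℕ, M ≤ N → EqOn (y M) (y N) (Icc 0 M) := by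
    intro M N hMN
    have hMN' : (M : ℝ) ≤ N := by exact_mod_cast hMN
    refine ODE_solution_unique (v := fun _ => F) (fun _ => hK)
      (fun t ht => (hy M t ht).continuousWithinAt) (hright M)
      (fun t ht => ((hy N t ⟨ht.1, ht.2.trans hMN'⟩).continuousWithinAt).mono
        (Icc_subset_Icc_right hMN'))
      (fun t ht => hright N t ⟨ht.1, ht.2.trans_le hMN'⟩) (by rw [hy0, hy0])
  have hagree : ∀ N : ℕ, ∀ s ∈ Icc (0 : ℝ) N, y (⌊s⌋₊ + 1) s = y N s := by
    intro N s hs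
    have hs' : s ∈ Icc (0 : ℝ) ((⌊s⌋₊ + 1 : ℕ) : ℝ) :=
      ⟨hs.1, by push_cast; exact (Nat.lt_floor_add_one s).le⟩
    rcases le_total (⌊s⌋₊ + 1) N with h | h
    · exact huniq _ _ h hs'
    · exact (huniq _ _ h hs).symm
  refine ⟨fun s => y (⌊s⌋₊ + 1) s, by simpa using hy0 _, fun t ht => ?_⟩
  have htN : t < ((⌊t⌋₊ + 1 : ℕ) : ℝ) := by push_cast; exact Nat.lt_floor_add_one t
  have hd := (hy (⌊t⌋₊ + 1) t ⟨ht, htN.le⟩).congr (fun s hs => hagree _ s hs)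
    (hagree _ t ⟨ht, htN.le⟩)
  refine hd.mono_of_mem_nhdsWithin ?_
  exact mem_of_superset (inter_mem_nhdsWithin (Ici 0) (Iio_mem_nhds htN))
    (fun s hs => ⟨hs.1, hs.2.le⟩)

end

/-! ### Stability from the linearization -/

section

open Set Filter Topology Metric

variable {V : Type*} [NormedAddCommGroup V] [NormedSpace ℝ V]

/-- Decay of perturbed linear flows: if `exp (t A)` decays at rate `β` and `v` is within `ε ‖y‖` of
`A y` as long as `‖y‖ ≤ r`, then a curve with derivative `v` that starts close enough to `0` decays
at rate `β - M ε`. -/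
theorem norm_lt_of_perturbed_linear [CompleteSpace V] {A : V →L[ℝ] V} {M β : ℝ} (hM : 1 ≤ M)
    (hA : ∀ t : ℝ, 0 ≤ t → ‖NormedSpace.exp (t • A)‖ ≤ M * Real.exp (-β * t))
    {ε r c T : ℝ} (hε : 0 ≤ ε) (hεβ : M * ε ≤ β) {y v : ℝ → V}
    (hy : ∀ t ∈ Ico 0 T, HasDerivWithinAt y (v t) (Ico 0 T) t)
    (hv : ∀ t ∈ Ico 0 T, ‖y t‖ ≤ r → ‖v t - A (y t)‖ ≤ ε * ‖y t‖)
    (hc : ‖y 0‖ < c) (hcr : M * c ≤ r) :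
    ∀ t ∈ Ico 0 T, ‖y t‖ < M * c * Real.exp (-(β - M * ε) * t) := by
  have hM0 : 0 < M := by linarith
  have hc0 : 0 < c := (norm_nonneg _).trans_lt hc
  have hMc : 0 < M * c := mul_pos hM0 hc0
  by_contra! hcon
  obtain ⟨t, ht, htu⟩ := hcon
  have hycont : ContinuousOn y (Ico 0 T) := fun s hs => (hy s hs).continuousWithinAt
  have hsub : Icc 0 t ⊆ Ico 0 T := fun s hs => ⟨hs.1, hs.2.trans_lt ht.2⟩
  -- the first time `t₁` at which the claimed bound fails
  obtain ⟨t₁, ⟨ht₁, hfail⟩, hleast⟩ : ∃ t₁, IsLeast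
      {s ∈ Icc 0 t | M * c * Real.exp (-(β - M * ε) * s) ≤ ‖y s‖} t₁ := by
    refine IsCompact.exists_isLeast ?_ ⟨t, ⟨ht.1, le_rfl⟩, htu⟩
    exact isCompact_Icc.of_isClosed_subset
      (isClosed_Icc.isClosed_le (by fun_prop) ((hycont.mono hsub).norm)) (sep_subset _ _)
  have hlt : ∀ s ∈ Ico 0 t₁, ‖y s‖ < M * c * Real.exp (-(β - M * ε) * s) := by
    intro s hs
    by_contra! h
    exact absurd (hleast ⟨⟨hs.1, hs.2.le.trans ht₁.2⟩, h⟩) (not_le.2 hs.2)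
  have hsub₁ : Icc 0 t₁ ⊆ Ico 0 T := (Icc_subset_Icc_right ht₁.2).trans hsub
  have hexp : ∀ s : ℝ, HasDerivAt (fun s : ℝ => NormedSpace.exp ((t₁ - s) • A))
      (-(NormedSpace.exp ((t₁ - s) • A) * A)) s := by
    intro s
    have h1 : HasDerivAt (fun s : ℝ => t₁ - s) (-1) s := by
      simpa using (hasDerivAt_id s).const_sub t₁
    convert! (hasDerivAt_exp_smul_const (𝕂 := ℝ) A (t₁ - s)).scomp s h1 using 1
    rw [neg_one_smul]
  have hφ : ∀ s ∈ Ico 0 T, HasDerivWithinAt (fun s : ℝ => NormedSpace.exp ((t₁ - s) • A) (y s))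
      (NormedSpace.exp ((t₁ - s) • A) (v s - A (y s))) (Ico 0 T) s := by
    intro s hs
    convert! (hexp s).hasDerivWithinAt.clm_apply (hy s hs) using 1
    simp [sub_eq_neg_add]
  -- `B` bounds `‖exp ((t₁ - s) A) (y s)‖` for `s ≤ t₁`; as `‖y 0‖ < c`, the value `B t₁` is smaller
  -- than the claimed bound at `t₁`
  set B : ℝ → ℝ := fun s => M * ‖y 0‖ * Real.exp (-β * t₁) +
    M * c * Real.exp (-β * t₁) * (Real.exp (M * ε * s) - 1) with hB
  have hBd : ∀ s, HasDerivAt B (M * c * Real.exp (-β * t₁) *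
      (Real.exp (M * ε * s) * (M * ε))) s := by
    intro s
    have h1 : HasDerivAt (fun s : ℝ => M * ε * s) (M * ε) s := by
      simpa using (hasDerivAt_id s).const_mul (M * ε)
    exact ((h1.exp.sub_const 1).const_mul _).const_add _
  have key := image_norm_le_of_norm_deriv_right_le_deriv_boundary (a := 0) (b := t₁)
    (f := fun s : ℝ => NormedSpace.exp ((t₁ - s) • A) (y s))
    (f' := fun s => NormedSpace.exp ((t₁ - s) • A) (v s - A (y s))) (B := B)
    (fun s hs => (hφ s (hsub₁ hs)).continuousWithinAt.mono hsub₁)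
    (fun s hs => (hφ s (hsub₁ ⟨hs.1, hs.2.le⟩)).mono_of_mem_nhdsWithin
      (mem_of_superset (Ico_mem_nhdsGE (hsub₁ ⟨hs.1, hs.2.le⟩).2) (Ico_subset_Ico_left hs.1)))
    (by
      have := (NormedSpace.exp (t₁ • A)).le_of_opNorm_le (hA t₁ ht₁.1) (y 0)
      simp only [hB, sub_zero, mul_zero, Real.exp_zero, sub_self, add_zero]
      linarith) hBd
    (by
      intro s hs
      have hys := hlt s hs
      have hyr : ‖y s‖ ≤ r := by
        have h1 : Real.exp (-(β - M * ε) * s) ≤ 1 :=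
          Real.exp_le_one_iff.2 (mul_nonpos_of_nonpos_of_nonneg (by linarith) hs.1)
        have h2 : M * c * Real.exp (-(β - M * ε) * s) ≤ M * c * 1 := by gcongr
        linarith
      have h1 := (NormedSpace.exp ((t₁ - s) • A)).le_of_opNorm_le
        (hA (t₁ - s) (by linarith [hs.2])) (v s - A (y s))
      refine h1.trans ?_
      have h2 := hv s (hsub₁ ⟨hs.1, hs.2.le⟩) hyr
      calc M * Real.exp (-β * (t₁ - s)) * ‖v s - A (y s)‖
          ≤ M * Real.exp (-β * (t₁ - s)) * (ε * (M * c * Real.exp (-(β - M * ε) * s))) := by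
            gcongr
            exact h2.trans (by gcongr)
        _ = M * c * (M * ε) * (Real.exp (-β * (t₁ - s)) * Real.exp (-(β - M * ε) * s)) := by ring
        _ = M * c * (M * ε) * (Real.exp (-β * t₁) * Real.exp (M * ε * s)) := by
            rw [← Real.exp_add, ← Real.exp_add]; ring_nf
        _ = _ := by ring)
  have h := key (right_mem_Icc.2 ht₁.1)
  simp only [sub_self, zero_smul, NormedSpace.exp_zero, one_apply_eq_self, hB] at h
  have h1 : M * ‖y 0‖ * Real.exp (-β * t₁) < M * c * Real.exp (-β * t₁) := by gcongr
  have h2 : Real.exp (-(β - M * ε) * t₁) = Real.exp (-β * t₁) * Real.exp (M * ε * t₁) := by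
    rw [← Real.exp_add]; ring_nf
  rw [h2] at hfail
  linarith

/-- **Lyapunov's indirect method**: an equilibrium at which the vector field is strictly
differentiable is locally exponentially stable if the linearized flow decays exponentially. -/
theorem locallyExponentiallyStable_of_hasStrictFDerivAt [CompleteSpace V] {f : V → V} {D : Set V}
    {p : V} {A : V →L[ℝ] V} (hf : HasStrictFDerivAt f A p) (hfp : f p = 0) (hD : D ∈ 𝓝 p)
    {M β : ℝ} (hM : 1 ≤ M) (hβ : 0 < β)
    (hA : ∀ t : ℝ, 0 ≤ t → ‖NormedSpace.exp (t • A)‖ ≤ M * Real.exp (-β * t)) :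
    LocallyExponentiallyStable f D p := by
  have hM0 : 0 < M := by linarith
  -- `ε` is chosen so that the perturbation costs half of the linear decay rate
  obtain ⟨ε, hεpos, hMε⟩ : ∃ ε : NNReal, 0 < ε ∧ M * (ε : ℝ) = β / 2 := by
    have h : 0 < β / (2 * M) := by positivity
    refine ⟨(β / (2 * M)).toNNReal, Real.toNNReal_pos.2 h, ?_⟩
    rw [Real.coe_toNNReal _ h.le]
    field_simp
  obtain ⟨s, hs, happ⟩ := hf.approximates_deriv_on_nhds (c := ε) (Or.inr hεpos)
  obtain ⟨r, hr, hball⟩ := nhds_basis_closedBall.mem_iff.1 (inter_mem hs hD)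
  have hmem : ∀ y : V, ‖y‖ ≤ r → p + y ∈ closedBall p r := fun y hy => by
    simpa [mem_closedBall, dist_eq_norm] using hy
  have hps : p ∈ s := mem_of_mem_nhds hs
  have hclose : ∀ y : V, ‖y‖ ≤ r → ‖f (p + y) - A y‖ ≤ ε * ‖y‖ := fun y hy => by
    simpa [hfp] using happ (p + y) (hball (hmem y hy)).1 p hps
  have hrM : 0 < r / M := div_pos hr hM0
  have hcr : ∀ c, c ≤ r / M → M * c ≤ r := fun c hc => by
    rw [mul_comm]; exact (le_div_iff₀ hM0).1 hc
  refine ⟨r / M, hrM, M, hM0, β / 2, by positivity, fun x₀ hx₀ => ⟨?_, ?_⟩⟩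
  · have hlip : LipschitzOnWith (‖A‖₊ + ε) f (closedBall p r) :=
      (lipschitzOnWith_iff_restrict.2 happ.lipschitz).mono (hball.trans inter_subset_left)
    set G : V → V := fun y => f (p + radialRetraction r y) with hG
    have hρ : ∀ y : V, p + radialRetraction r y ∈ closedBall p r :=
      fun y => hmem _ (norm_radialRetraction_le hr y)
    have hGlip : LipschitzWith ((‖A‖₊ + ε) * 2) G := by
      refine LipschitzWith.of_dist_le_mul fun x y => ?_
      refine (hlip.dist_le_mul _ (hρ x) _ (hρ y)).trans ?_
      rw [dist_add_left, NNReal.coe_mul, mul_assoc]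
      gcongr
      exact (lipschitzWith_radialRetraction hr).dist_le_mul x y
    have hGbd : ∀ y, ‖G y‖ ≤ ((‖A‖₊ + ε) * r.toNNReal : NNReal) := by
      intro y
      have h1 := hlip.dist_le_mul _ (hρ y) _ (mem_closedBall_self hr.le)
      rw [hfp, dist_zero_right] at h1
      refine h1.trans ?_
      rw [NNReal.coe_mul, Real.coe_toNNReal _ hr.le]
      gcongr
      exact hρ y
    obtain ⟨y, hy0, hy⟩ := exists_forward_solution_of_lipschitzWith hGlip hGbd (x₀ - p)
    have hGf : ∀ z : V, ‖z‖ ≤ r → G z = f (p + z) := fun z hz => by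
      rw [hG]; simp only [radialRetraction_of_norm_le hr hz]
    have hyr : ∀ t ∈ Ici (0 : ℝ), ‖y t‖ ≤ r := by
      intro t ht
      obtain ⟨c, hc1, hc2⟩ := exists_between hx₀
      have h := norm_lt_of_perturbed_linear (T := t + 1) (r := r) (y := y) (v := fun t => G (y t))
        hM hA ε.coe_nonneg (by rw [hMε]; linarith)
        (fun t ht => (hy t ht.1).mono Ico_subset_Ici_self)
        (fun t _ htr => by rw [hGf _ htr]; exact hclose _ htr) (hy0 ▸ hc1) (hcr c hc2.le)
        t ⟨ht, by linarith⟩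
      have hc0 : 0 < c := (norm_nonneg _).trans_lt hc1
      have h1 : Real.exp (-(β - M * (ε : ℝ)) * t) ≤ 1 :=
        Real.exp_le_one_iff.2 (mul_nonpos_of_nonpos_of_nonneg (by rw [hMε]; linarith) ht)
      have h2 : M * c * Real.exp (-(β - M * (ε : ℝ)) * t) ≤ M * c * 1 := by gcongr
      rw [mul_one] at h2
      exact h.le.trans (h2.trans (hcr c hc2.le))
    refine ⟨fun t => p + y t, by simp [hy0], fun t ht =>
      ⟨(hball (hmem _ (hyr t ht))).2, ?_⟩⟩
    have := (hy t ht).const_add p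
    rwa [hGf _ (hyr t ht)] at this
  · intro T _ x hx0 hx t ht
    have hx' : ∀ c, ‖x₀ - p‖ < c → c ≤ r / M →
        ‖x t - p‖ < M * c * Real.exp (-(β - M * (ε : ℝ)) * t) := by
      intro c hc1 hc2
      refine norm_lt_of_perturbed_linear (T := T) (r := r) (y := fun t => x t - p)
        (v := fun t => f (x t))
        hM hA ε.coe_nonneg (by rw [hMε]; linarith)
        (fun t ht => (hx t ht).2.sub_const p)
        (fun t _ htr => by simpa using hclose _ htr) (by rwa [hx0]) (hcr c hc2) t ht
    have hrate : -(β - M * (ε : ℝ)) * t = -(β / 2) * t := by rw [hMε]; ring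
    rw [hrate] at hx'
    -- the strict bound needs `c > ‖x₀ - p‖`, so `c` is sent to `‖x₀ - p‖`
    have hlim : Tendsto (fun c : ℝ => M * c * Real.exp (-(β / 2) * t)) (𝓝[>] ‖x₀ - p‖)
        (𝓝 (M * ‖x₀ - p‖ * Real.exp (-(β / 2) * t))) :=
      (Continuous.tendsto (by fun_prop) _).mono_left nhdsWithin_le_nhds
    have hle : ‖x t - p‖ ≤ M * ‖x₀ - p‖ * Real.exp (-(β / 2) * t) := by
      refine ge_of_tendsto hlim ?_
      filter_upwards [Ioo_mem_nhdsGT hx₀] with c hc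
      exact (hx' c hc.1 hc.2.le).le
    linarith

end

/-! ### The companion matrix -/

/-- The companion-type matrix of `s ^ d + a_{d-1} s ^ (d-1) + ⋯ + a_0`: ones above the diagonal and
first column `-a_{d-1}, …, -a_0`. -/
def companionMatrix {d : ℕ} [NeZero d] (a : Fin d → ℝ) : Matrix (Fin d) (Fin d) ℝ :=
  Matrix.of fun j k => (if (k : ℕ) = j + 1 then 1 else 0) - if k = 0 then a j.rev else 0

theorem sum_companionMatrix_smul {d : ℕ} [NeZero d] {W : Type*} [AddCommGroup W] [Module ℝ W]
    (a : Fin d → ℝ) (x : Fin d → W) (j : Fin d) :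
    ∑ k, companionMatrix a j k • x k =
      (if h : (j : ℕ) + 1 < d then x ⟨j + 1, h⟩ else 0) - a j.rev • x 0 := by
  simp only [companionMatrix, Matrix.of_apply, sub_smul, Finset.sum_sub_distrib, ite_smul, one_smul,
    zero_smul, Finset.sum_ite_eq', Finset.mem_univ, if_true]
  congr 1
  split_ifs with h
  · rw [Finset.sum_eq_single ⟨j + 1, h⟩] <;> simp +contextual [Fin.ext_iff]
  · refine Finset.sum_eq_zero fun k _ => if_neg ?_
    have := k.2
    omega

theorem aeval_monicPoly {d : ℕ} (a : Fin d → ℝ) (z : ℂ) :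
    Polynomial.aeval z (monicPoly a) = z ^ d + ∑ i : Fin d, (a i : ℂ) * z ^ (i : ℕ) := by
  simp [monicPoly]

/-- Every eigenvalue of the companion matrix is a root of its polynomial: by Horner's scheme the
components of an eigenvector are determined by the first one. -/
theorem aeval_monicPoly_eq_zero_of_mem_spectrum {d : ℕ} [NeZero d] (a : Fin d → ℝ) {z : ℂ}
    (hz : z ∈ spectrum ℂ ((companionMatrix a).map (algebraMap ℝ ℂ))) :
    Polynomial.aeval z (monicPoly a) = 0 := by
  obtain ⟨v, hv, hCv⟩ := Matrix.mem_spectrum_iff_exists_mulVec.1 hz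
  have hrow : ∀ j : Fin d, (if h : (j : ℕ) + 1 < d then v ⟨j + 1, h⟩ else 0) =
      z * v j + a j.rev * v 0 := by
    intro j
    have h1 := congrFun hCv j
    have h2 := sum_companionMatrix_smul a v j
    simp only [Matrix.mulVec, dotProduct, Matrix.map_apply, Complex.coe_algebraMap,
      Pi.smul_apply, smul_eq_mul] at h1
    simp only [Complex.real_smul] at h2
    rw [h1] at h2
    rw [h2]; ring
  -- `w` extends `v` by `w d = 0`, and `b i = a_{d-1-i}`
  set w : ℕ → ℂ := fun j => if h : j < d then v ⟨j, h⟩ else 0 with hw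
  set b : ℕ → ℂ := fun i => if h : i < d then a (Fin.rev ⟨i, h⟩) else 0 with hb
  have hd : 0 < d := Nat.pos_of_ne_zero (NeZero.ne d)
  have hw0 : w 0 = v 0 := by simp only [hw, hd, dif_pos]; rfl
  have hrec : ∀ j < d, w (j + 1) = z * w j + b j * w 0 := by
    intro j hj
    rw [hw0]
    simpa only [hw, hb, hj, dif_pos] using hrow ⟨j, hj⟩
  have hhorner : ∀ j ≤ d, w j = (z ^ j + ∑ i ∈ Finset.range j, b i * z ^ (j - 1 - i)) * w 0 := by
    intro j
    induction j with
    | zero => simp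
    | succ j ih =>
      intro hj
      rw [hrec j hj, ih (by omega), Finset.sum_range_succ, pow_succ']
      have : ∑ i ∈ Finset.range j, b i * z ^ (j + 1 - 1 - i) =
          z * ∑ i ∈ Finset.range j, b i * z ^ (j - 1 - i) := by
        rw [Finset.mul_sum]
        refine Finset.sum_congr rfl fun i hi => ?_
        have hi' := Finset.mem_range.1 hi
        rw [show j + 1 - 1 - i = (j - 1 - i) + 1 by omega, pow_succ]; ring
      rw [this]
      simp only [add_tsub_cancel_right, tsub_self, pow_zero]
      ring
  have hv0 : w 0 ≠ 0 := by
    intro h0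
    refine hv (funext fun j => ?_)
    have := hhorner j j.2.le
    rw [h0, mul_zero] at this
    simpa [hw] using this
  have hwd : w d = 0 := by simp [hw]
  have hlast := hhorner d le_rfl
  rw [hwd, eq_comm, mul_eq_zero, or_iff_left hv0] at hlast
  rw [aeval_monicPoly, ← hlast, ← Equiv.sum_comp Fin.revPerm, Finset.sum_range]
  congr 1
  refine Finset.sum_congr rfl fun i _ => ?_
  simp only [Fin.revPerm_apply, hb, i.2, dif_pos, Fin.val_rev, Fin.eta]
  congr 2
  omega

/-! ### The linearized equation -/

section

open Filter Topology

/-- The action of `d × d` real matrices on `d`-tuples of vectors by linear combinations. -/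
noncomputable def tupleAction (W : Type*) [NormedAddCommGroup W] [NormedSpace ℝ W] (d : ℕ) :
    Matrix (Fin d) (Fin d) ℝ →ₐ[ℝ] ((Fin d → W) →L[ℝ] (Fin d → W)) :=
  AlgHom.ofLinearMap
    { toFun := fun C => ContinuousLinearMap.pi fun j => ∑ k, C j k • ContinuousLinearMap.proj k
      map_add' := fun C C' => by
        ext x j : 2
        simp [add_smul, Finset.sum_add_distrib]
      map_smul' := fun c C => by
        ext x j : 2
        simp [Finset.smul_sum, smul_smul] }
    (by
      ext x j : 2
      simp [Matrix.one_apply])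
    (fun C C' => by
      ext x j : 2
      simp only [LinearMap.coe_mk, AddHom.coe_mk, ContinuousLinearMap.coe_pi',
        mul_apply_eq_comp, sum_apply, smul_apply,
        ContinuousLinearMap.proj_apply, Matrix.mul_apply, Finset.sum_smul, Finset.smul_sum,
        smul_smul]
      exact Finset.sum_comm)

theorem tupleAction_apply {W : Type*} [NormedAddCommGroup W] [NormedSpace ℝ W] {d : ℕ}
    (C : Matrix (Fin d) (Fin d) ℝ) (x : Fin d → W) (j : Fin d) :
    tupleAction W d C x j = ∑ k, C j k • x k := by
  simp [tupleAction]

theorem tupleAction_companionMatrix_apply {n d : ℕ} [NeZero d] (a : Fin d → ℝ)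
    (x : Fin d → Matrix (Fin n) (Fin n) ℝ) (j : Fin d) :
    tupleAction (Matrix (Fin n) (Fin n) ℝ) d (companionMatrix a) x j =
      nextState x j - a j.rev • x 0 := by
  rw [tupleAction_apply, sum_companionMatrix_smul, nextState]

theorem tendsto_exp_tupleAction_companionMatrix_pow (W : Type*) [NormedAddCommGroup W]
    [NormedSpace ℝ W] [CompleteSpace W] {d : ℕ} [NeZero d] {a : Fin d → ℝ}
    (ha : IsHurwitz (monicPoly a)) :
    Tendsto (fun k : ℕ => NormedSpace.exp (tupleAction W d (companionMatrix a)) ^ k)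
      atTop (𝓝 0) := by
  have hC := Matrix.tendsto_exp_pow_zero (C := (companionMatrix a).map (algebraMap ℝ ℂ))
    fun z hz => ha z (aeval_monicPoly_eq_zero_of_mem_spectrum a hz)
  have hre : Continuous fun X : Matrix (Fin d) (Fin d) ℂ => X.map Complex.re :=
    continuous_id.matrix_map Complex.continuous_re
  have hΨ : Continuous (tupleAction W d) :=
    LinearMap.continuous_of_finiteDimensional (tupleAction W d).toLinearMap
  have hlim := ((hΨ.comp hre).tendsto 0).comp hC
  rw [Function.comp_apply, Matrix.map_zero _ Complex.zero_re, map_zero] at hlim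
  refine hlim.congr fun k => ?_
  let _ : NormedAlgebra ℚ (Matrix (Fin d) (Fin d) ℝ) := NormedAlgebra.restrictScalars ℚ ℝ _
  let _ : NormedAlgebra ℚ ((Fin d → W) →L[ℝ] (Fin d → W)) := NormedAlgebra.restrictScalars ℚ ℝ _
  have hpow : NormedSpace.exp ((companionMatrix a).map (algebraMap ℝ ℂ)) ^ k =
      (NormedSpace.exp (companionMatrix a) ^ k).map (algebraMap ℝ ℂ) := by
    rw [Matrix.exp_map_algebraMap]
    exact (map_pow ((algebraMap ℝ ℂ).mapMatrix (m := Fin d)) _ k).symm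
  rw [Function.comp_apply, Function.comp_apply, hpow, ← NormedSpace.map_exp _ hΨ, ← map_pow]
  congr 1

theorem exists_norm_exp_tupleAction_companionMatrix_le (W : Type*) [NormedAddCommGroup W]
    [NormedSpace ℝ W] [CompleteSpace W] {d : ℕ} [NeZero d] {a : Fin d → ℝ}
    (ha : IsHurwitz (monicPoly a)) :
    ∃ M ≥ (1 : ℝ), ∃ β > (0 : ℝ), ∀ t : ℝ, 0 ≤ t →
      ‖NormedSpace.exp (t • tupleAction W d (companionMatrix a))‖ ≤ M * Real.exp (-β * t) :=
  exists_norm_exp_smul_le (tendsto_exp_tupleAction_companionMatrix_pow W ha)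

end

/-! ### The error equation -/

section

open Topology

/-- The map `x ↦ nextState x j` as a continuous linear map. -/
noncomputable def nextStateCLM (n : ℕ) {d : ℕ} (j : Fin d) :
    (Fin d → Matrix (Fin n) (Fin n) ℝ) →L[ℝ] Matrix (Fin n) (Fin n) ℝ :=
  if h : (j : ℕ) + 1 < d then ContinuousLinearMap.proj ⟨j + 1, h⟩ else 0

theorem nextStateCLM_apply {n d : ℕ} (j : Fin d) (x : Fin d → Matrix (Fin n) (Fin n) ℝ) :
    nextStateCLM n j x = nextState x j := by
  unfold nextStateCLM nextState
  split_ifs <;> rfl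

theorem errorEquilibrium_zero (n d : ℕ) [NeZero d] : errorEquilibrium n d 0 = 1 :=
  if_pos rfl

theorem nextState_errorEquilibrium {n d : ℕ} [NeZero d] (j : Fin d) :
    nextState (errorEquilibrium n d) j = 0 := by
  unfold nextState errorEquilibrium
  split_ifs with h h'
  · exact absurd (congrArg Fin.val h') (Nat.succ_ne_zero _)
  · rfl
  · rfl

/-- The linearization of the error equation is `ẋ_j = x_{j+1} - a_{d-1-j} x_0`. -/
theorem hasStrictFDerivAt_errorField {n d : ℕ} [NeZero d] (a : Fin d → ℝ) :
    HasStrictFDerivAt (errorField a) (tupleAction (Matrix (Fin n) (Fin n) ℝ) d (companionMatrix a))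
      (errorEquilibrium n d) := by
  obtain ⟨hlog, hlog1⟩ := hasStrictFDerivAt_principalLog_one n
  have hp0 := errorEquilibrium_zero n d
  have h0 : HasStrictFDerivAt (fun x : Fin d → Matrix (Fin n) (Fin n) ℝ => x 0)
      (ContinuousLinearMap.proj (R := ℝ) (φ := fun _ => Matrix (Fin n) (Fin n) ℝ) 0)
      (errorEquilibrium n d) :=
    hasStrictFDerivAt_apply 0 _
  have hl : HasStrictFDerivAt (fun x : Fin d → Matrix (Fin n) (Fin n) ℝ => principalLog (x 0))
      (ContinuousLinearMap.proj (R := ℝ) (φ := fun _ => Matrix (Fin n) (Fin n) ℝ) 0)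
      (errorEquilibrium n d) := by
    rw [← hp0] at hlog
    simpa using hlog.comp (errorEquilibrium n d) h0
  have hnext : ∀ j : Fin d, HasStrictFDerivAt
      (fun x : Fin d → Matrix (Fin n) (Fin n) ℝ => nextState x j)
      (nextStateCLM n j) (errorEquilibrium n d) := fun j => by
    simpa [funext (nextStateCLM_apply (n := n) j)] using
      (nextStateCLM n j).hasStrictFDerivAt (x := errorEquilibrium n d)
  rw [hasStrictFDerivAt_pi']
  intro j
  by_cases hj : j = 0
  · have h := ((hnext j).mul' h0).sub ((h0.mul' hl).const_smul (a j.rev))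
    simp only [errorField, hj, if_true]
    rw [hj] at h
    convert! h using 1
    ext x : 1
    simp [tupleAction_companionMatrix_apply, nextStateCLM_apply, hp0, hlog1,
      nextState_errorEquilibrium]
  · have h := (hnext j).sub (hl.const_smul (a j.rev))
    simp only [errorField, hj, if_false]
    convert! h using 1
    ext x : 1
    simp [tupleAction_companionMatrix_apply, nextStateCLM_apply]

theorem principalLogDomain_mem_nhds_one (n : ℕ) : principalLogDomain n ∈ 𝓝 1 := by
  have hcont : Continuous fun X : Matrix (Fin n) (Fin n) ℝ =>
      ‖1 - X‖ * ‖(1 : Matrix (Fin n) (Fin n) ℝ)‖ := by fun_prop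
  filter_upwards [hcont.continuousAt.eventually_lt continuousAt_const
    (show _ < (1 : ℝ) by simp)] with X hX μ hμ
  have h1 : 1 - μ ∈ spectrum ℝ (1 - X) := by
    have h2 := Set.sub_mem_sub (Set.mem_singleton (1 : ℝ)) hμ
    rwa [spectrum.singleton_sub_eq, map_one] at h2
  have := (le_abs_self _).trans_lt ((spectrum.norm_le_norm_mul_of_mem h1).trans_lt hX)
  linarith

theorem errorDomain_mem_nhds_errorEquilibrium (n d : ℕ) [NeZero d] :
    errorDomain n d ∈ 𝓝 (errorEquilibrium n d) :=
  (continuous_apply (0 : Fin d)).continuousAt.preimage_mem_nhds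
    (by rw [errorEquilibrium_zero]; exact principalLogDomain_mem_nhds_one n)

theorem errorField_errorEquilibrium (n : ℕ) {d : ℕ} [NeZero d] (a : Fin d → ℝ) :
    errorField a (errorEquilibrium n d) = 0 := by
  funext j
  have := (hasStrictFDerivAt_principalLog_one n).2
  simp [errorField, errorEquilibrium_zero, this, nextState_errorEquilibrium]

theorem mainTheorem5 (n d : ℕ) [NeZero d] (a : Fin d → ℝ) (ha : IsHurwitz (monicPoly a)) :
    IsEquilibrium (errorField a) (errorDomain n d) (errorEquilibrium n d) ∧
      LocallyExponentiallyStable (errorField a) (errorDomain n d) (errorEquilibrium n d) := by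
  have hD := errorDomain_mem_nhds_errorEquilibrium n d
  have hfp := errorField_errorEquilibrium n a
  obtain ⟨M, hM, β, hβ, hdecay⟩ :=
    exists_norm_exp_tupleAction_companionMatrix_le (Matrix (Fin n) (Fin n) ℝ) ha
  exact ⟨⟨mem_of_mem_nhds hD, hfp⟩,
    locallyExponentiallyStable_of_hasStrictFDerivAt (hasStrictFDerivAt_errorField a) hfp hD hM hβ
      hdecay⟩

end
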